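/- All graphs are finite and simple, $\rho(G)$ denotes the largest eigenvalue of the adjacency matrix of $G$, and an $(a,b)$-parity factor of $G$ is a spanning subgraph $F$ of $G$ such that $d_F(v)\equiv b \pmod 2$ and $a\le d_F(v)\le b$ for every vertex $v$ of $G$. Let $a,b,n$ be positive integers such that $a\le b$, $a\equiv b\pmod 2$, $na$ is even, and $n\ge\max\{2a(a+1)+b-3,\,(2a+2)(a+1)\}$. Let $H_{n,a}=K_{a-1}\nabla(K_1\cup K_{n-a})$, where $K_s$ is the complete graph on $s$ vertices ($K_0$ is empty), $\cup$ is the disjoint union, and $G_1\nabla G_2$ is obtained from the disjoint union of $G_1$ and $G_2$ by adding all edges between $G_1$ and $G_2$. If $G$ is a graph of order $n$ with $\rho(G)\ge\rho(H_{n,a})$ and $G\not\cong H_{n,a}$, then $G$ has an $(a,b)$-parity factor. Moreover, $H_{n,a}$ itself has no $(a,b)$-parity factor. -/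

import Mathlib

namespace ParityFactor

/-- The join of `G` and `H`: their disjoint union together with all edges between them. -/
def join {V W : Type*} (G : SimpleGraph V) (H : SimpleGraph W) : SimpleGraph (V ⊕ W) :=
  (G ⊕g H) ⊔ completeBipartiteGraph V W

/-- The graph `H_{n,a} = K_{a-1} ∇ (K_1 ∪ K_{n-a})`. It is meant for `1 ≤ a ≤ n`, and then it has
`n` vertices. -/
def extremalGraph (n a : ℕ) : SimpleGraph (Fin (a - 1) ⊕ (Fin 1 ⊕ Fin (n - a))) :=
  join (⊤ : SimpleGraph (Fin (a - 1)))
    ((⊤ : SimpleGraph (Fin 1)) ⊕g (⊤ : SimpleGraph (Fin (n - a))))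

open Classical in
/-- The spectral radius of a finite graph: the largest eigenvalue of its adjacency matrix.
(The supremum is a maximum over a finite index set, nonempty as soon as `G` has a vertex.) -/
noncomputable def rho {V : Type*} [Fintype V] (G : SimpleGraph V) : ℝ :=
  ⨆ v : V, (G.isHermitian_adjMatrix ℝ).eigenvalues v

open Classical in
/-- `G` has an `(a, b)`-parity factor: a spanning subgraph `F` all of whose degrees lie in `[a, b]`
and are congruent to `b` modulo `2`. (A spanning subgraph has the vertex set of `G`, so it
is a graph `F ≤ G` on the same vertex type.) -/
def HasParityFactor {V : Type*} [Fintype V] (G : SimpleGraph V) (a b : ℕ) : Prop :=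
  ∃ F : SimpleGraph V, F ≤ G ∧ ∀ v : V, F.degree v ≡ b [MOD 2] ∧ a ≤ F.degree v ∧ F.degree v ≤ b

end ParityFactor

/-! More is true: $G$ has an $a$-regular factor, which is an $(a,b)$-parity factor because $a\le b$
and $a\equiv b$ mod 2.

The spectral hypothesis is used twice. Since $H_{n,a}$ contains $K_{n-1}$, $\rho(G)\ge n-2$, and
`card_mul_sq_rho_le` turns this into many edges: the complement of $G$ has fewer than $n$. If some
degree were below $a$, then $G$ would be a spanning subgraph of $H_{n,a}$; a proper one has strictly
smaller $\rho$ (`rho_lt_rho_extremalGraph`), so the minimum degree is at least $a$.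

The rest is an exchange argument (`exists_regular_factor`). Only a vertex $v$ of minimum degree can
miss nearly all others, so $a$ edges at $v$ are fixed in advance. A largest subgraph $F$ containing
them, with no other edge at $v$ and all degrees at most $a$, is $a$-regular: two deficient vertices
allow an augmentation, and a single one, deficient by at least 2 by parity, can be traded for two.

In $H_{n,a}$ itself, a vertex of degree $a-1$ rules out a factor. -/

namespace ParityFactor

/-! ### Real symmetric matrices through their spectral decomposition. -/

section Hermitian

open Matrix

variable {ι : Type*} [Fintype ι] [DecidableEq ι] {A : Matrix ι ι ℝ}

theorem sum_sq_eigenvalues (hA : A.IsHermitian) : ∑ i, hA.eigenvalues i ^ 2 = (A * A).trace := by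
  conv_rhs => rw [hA.spectral_theorem, ← map_mul, Unitary.conjStarAlgAut_apply, trace_mul_cycle,
    Unitary.coe_star_mul_self, one_mul, diagonal_mul_diagonal, trace_diagonal]
  simp [pow_two]

theorem posSemidef_smul_one_sub (hA : A.IsHermitian) {r : ℝ} (hr : ∀ i, hA.eigenvalues i ≤ r) :
    (r • (1 : Matrix ι ι ℝ) - A).PosSemidef := by
  have h : r • (1 : Matrix ι ι ℝ) - A =
      Unitary.conjStarAlgAut ℝ _ hA.eigenvectorUnitary (diagonal fun i => r - hA.eigenvalues i) := by
    conv_lhs => rw [hA.spectral_theorem,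
      ← map_one (Unitary.conjStarAlgAut ℝ _ hA.eigenvectorUnitary), ← map_smul, ← map_sub]
    congr 1
    ext i j
    by_cases hij : i = j
    · subst hij; simp
    · simp [hij]
  rw [h, Unitary.conjStarAlgAut_apply]
  exact (PosSemidef.diagonal fun i => sub_nonneg.2 (hr i)).mul_mul_conjTranspose_same _

end Hermitian

/-! ### Rayleigh quotients and the spectral radius. -/

section Spectral

open Classical

variable {V : Type*} [Fintype V] (G : SimpleGraph V)

theorem eigenvalues_le_rho (v : V) : (G.isHermitian_adjMatrix ℝ).eigenvalues v ≤ rho G :=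
  le_ciSup (Set.finite_range _).bddAbove v

theorem exists_eigenvalues_eq_rho [Nonempty V] :
    ∃ v, (G.isHermitian_adjMatrix ℝ).eigenvalues v = rho G :=
  exists_eq_ciSup_of_finite

theorem exists_rho_eigenvector [Nonempty V] :
    ∃ x : V → ℝ, x ≠ 0 ∧ ∀ u, ∑ w, (if G.Adj u w then x w else 0) = rho G * x u := by
  obtain ⟨v, hv⟩ := exists_eigenvalues_eq_rho G
  have h := (G.isHermitian_adjMatrix ℝ).mulVec_eigenvectorBasis v
  refine ⟨(G.isHermitian_adjMatrix ℝ).eigenvectorBasis v, ?_, fun u => ?_⟩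
  · intro h0
    apply (G.isHermitian_adjMatrix ℝ).eigenvectorBasis.orthonormal.ne_zero v
    ext i
    exact congrFun h0 i
  · have := congrFun h u
    rw [hv] at this
    simpa [Matrix.mulVec, dotProduct, SimpleGraph.adjMatrix_apply] using this

/-- The quadratic form of the adjacency matrix. -/
noncomputable def adjForm (x : V → ℝ) : ℝ := ∑ u, ∑ w, if G.Adj u w then x u * x w else 0

theorem dotProduct_smul_one_sub_adjMatrix (r : ℝ) (x : V → ℝ) :
    star x ⬝ᵥ (Matrix.mulVec (r • (1 : Matrix V V ℝ) - G.adjMatrix ℝ) x) =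
      r * ∑ u, x u ^ 2 - adjForm G x := by
  rw [Matrix.sub_mulVec, Matrix.smul_mulVec, Matrix.one_mulVec, dotProduct_sub, dotProduct_smul]
  simp [adjForm, Matrix.mulVec, dotProduct, SimpleGraph.adjMatrix_apply, Finset.mul_sum, pow_two]

theorem adjForm_le (x : V → ℝ) : adjForm G x ≤ rho G * ∑ u, x u ^ 2 := by
  have h := (posSemidef_smul_one_sub _ (eigenvalues_le_rho G)).dotProduct_mulVec_nonneg x
  rw [dotProduct_smul_one_sub_adjMatrix] at h
  linarith

/-- A vector annihilated by the quadratic form of the positive semidefinite matrix $\rho I-A$ lies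
in its kernel. -/
theorem eigenvector_of_adjForm_eq {x : V → ℝ} (hx : adjForm G x = rho G * ∑ u, x u ^ 2) (u : V) :
    ∑ w, (if G.Adj u w then x w else 0) = rho G * x u := by
  have h := ((posSemidef_smul_one_sub _ (eigenvalues_le_rho G)).dotProduct_mulVec_zero_iff x).1
    (by rw [dotProduct_smul_one_sub_adjMatrix, hx, sub_self])
  have := congrFun h u
  rw [Matrix.sub_mulVec, Matrix.smul_mulVec, Matrix.one_mulVec] at this
  simp [Matrix.mulVec, dotProduct, SimpleGraph.adjMatrix_apply] at this
  linarith

/-- The eigenvalues sum to 0 and their squares to the degree sum. Cauchy–Schwarz is applied to the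
$n-1$ eigenvalues other than one copy of $\rho$, whose sum is $-\rho$. -/
theorem card_mul_sq_rho_le [Nonempty V] :
    (Fintype.card V : ℝ) * rho G ^ 2 ≤ (Fintype.card V - 1) * ∑ v, (G.degree v : ℝ) := by
  obtain ⟨v, hv⟩ := exists_eigenvalues_eq_rho G
  set f := (G.isHermitian_adjMatrix ℝ).eigenvalues with hf
  have h1 : ∑ i, f i = 0 := by
    have := (G.isHermitian_adjMatrix ℝ).trace_eq_sum_eigenvalues
    rw [SimpleGraph.trace_adjMatrix] at this
    exact_mod_cast this.symm
  have h2 : ∑ i, f i ^ 2 = ∑ v, (G.degree v : ℝ) := by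
    rw [hf, sum_sq_eigenvalues, Matrix.trace]
    exact Finset.sum_congr rfl fun i _ => by
      rw [Matrix.diag_apply, SimpleGraph.adjMatrix_mul_self_apply_self]
  rw [← Finset.add_sum_erase _ _ (Finset.mem_univ v)] at h1 h2
  have h3 := sq_sum_le_card_mul_sum_sq (s := Finset.univ.erase v) (f := f)
  have hc : (((Finset.univ.erase v).card : ℕ) : ℝ) = Fintype.card V - 1 := by
    rw [Finset.card_erase_of_mem (Finset.mem_univ v), Finset.card_univ,
      Nat.cast_sub Fintype.card_pos, Nat.cast_one]
  rw [hc] at h3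
  rw [hv] at h1 h2
  rw [← h2]
  have : ∑ i ∈ Finset.univ.erase v, f i = - rho G := by linarith
  rw [this] at h3
  linarith

end Spectral
-- Equality in the monotonicity of the spectral radius.
section Comparison

open Classical

variable {V W : Type*} [Fintype V] [Fintype W]

/-- If `G` is a spanning subgraph of `H` and `rho H ≤ rho G`, then `H` has a nonnegative
eigenvector for `rho H` which vanishes at an end of each edge of `H` outside `G`. -/
theorem exists_nonneg_eigenvector_of_rho_le [Nonempty V] {G : SimpleGraph V} {H : SimpleGraph W}
    (e : V ≃ W) (hle : ∀ u w, G.Adj u w → H.Adj (e u) (e w)) (hρ : rho H ≤ rho G) :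
    ∃ y : W → ℝ, y ≠ 0 ∧ (∀ w, 0 ≤ y w) ∧
      (∀ u, ∑ w, (if H.Adj u w then y w else 0) = rho H * y u) ∧
      ∀ u w, H.Adj (e u) (e w) → ¬ G.Adj u w → y (e u) * y (e w) = 0 := by
  obtain ⟨x, hx0, hx⟩ := exists_rho_eigenvector G
  set y : W → ℝ := fun w => |x (e.symm w)| with hy
  have hye : ∀ u, y (e u) = |x u| := fun u => by simp [hy]
  have hy0 : ∀ w, 0 ≤ y w := fun w => abs_nonneg _
  have hsq : ∑ w, y w ^ 2 = ∑ u, x u ^ 2 := by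
    rw [← e.sum_comp]; simp [hye]
  have hG : rho G * ∑ u, x u ^ 2 = adjForm G x := by
    rw [adjForm, Finset.mul_sum]
    refine Finset.sum_congr rfl fun u _ => ?_
    rw [pow_two, mul_left_comm, ← hx u, Finset.mul_sum]
    exact Finset.sum_congr rfl fun w _ => by split_ifs <;> simp
  have hH : adjForm H y =
      ∑ u, ∑ w, if H.Adj (e u) (e w) then y (e u) * y (e w) else 0 := by
    rw [adjForm, ← e.sum_comp]
    exact Finset.sum_congr rfl fun u _ => (e.sum_comp _).symm
  have hterm : ∀ u w, (if G.Adj u w then x u * x w else 0) ≤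
      if H.Adj (e u) (e w) then y (e u) * y (e w) else 0 := fun u w => by
    by_cases h : G.Adj u w
    · rw [if_pos h, if_pos (hle u w h), hye, hye, ← abs_mul]
      exact le_abs_self _
    · rw [if_neg h]
      split_ifs
      · exact mul_nonneg (hy0 _) (hy0 _)
      · exact le_rfl
  have hsum : adjForm G x ≤ adjForm H y := by
    rw [hH, adjForm]
    exact Finset.sum_le_sum fun u _ => Finset.sum_le_sum fun w _ => hterm u w
  have hpos : 0 ≤ ∑ u, x u ^ 2 := Finset.sum_nonneg fun _ _ => sq_nonneg _
  have hup := adjForm_le H y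
  have hρ' := mul_le_mul_of_nonneg_right hρ hpos
  rw [hsq] at hup
  have hEq : adjForm G x = adjForm H y := by linarith
  refine ⟨y, ?_, hy0, eigenvector_of_adjForm_eq H (by rw [hsq]; linarith), fun u w hH' hG' => ?_⟩
  · intro h
    apply hx0
    funext u
    have := congrFun h (e u)
    rw [hye] at this
    simpa using this
  · rw [hH, adjForm] at hEq
    have h1 := (Finset.sum_eq_sum_iff_of_le
      (fun u _ => Finset.sum_le_sum fun w _ => hterm u w)).1 hEq u (Finset.mem_univ u)
    have h2 := (Finset.sum_eq_sum_iff_of_le (fun w _ => hterm u w)).1 h1 w (Finset.mem_univ w)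
    rw [if_neg hG', if_pos hH'] at h2
    exact h2.symm

end Comparison

/-! ### The extremal graph, and what the spectral hypothesis gives. -/

section Extremal

open Classical

variable {n a : ℕ}

/-- The vertex of degree `a - 1` of the extremal graph. -/
abbrev lowVertex (n a : ℕ) : Fin (a - 1) ⊕ (Fin 1 ⊕ Fin (n - a)) := Sum.inr (Sum.inl 0)

theorem extremalGraph_adj_iff_ne {u w : Fin (a - 1) ⊕ (Fin 1 ⊕ Fin (n - a))}
    (hu : u ≠ lowVertex n a) (hw : w ≠ lowVertex n a) : (extremalGraph n a).Adj u w ↔ u ≠ w := by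
  rcases u with u | u | u <;> rcases w with w | w | w <;>
    simp [extremalGraph, join, lowVertex, Subsingleton.elim _ (0 : Fin 1)] at hu hw ⊢

theorem extremalGraph_adj_lowVertex {w : Fin (a - 1) ⊕ (Fin 1 ⊕ Fin (n - a))} :
    (extremalGraph n a).Adj (lowVertex n a) w ↔ ∃ i, w = Sum.inl i := by
  rcases w with w | w | w <;> simp [extremalGraph, join, lowVertex, Subsingleton.elim _ (0 : Fin 1)]

theorem sub_two_le_rho_extremalGraph (ha : 0 < a) (han : a ≤ n) (hn : 2 ≤ n) :
    (n : ℝ) - 2 ≤ rho (extremalGraph n a) := by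
  -- The test vector is the indicator of the clique $K_{n-1}$ left after deleting the low vertex.
  set y : Fin (a - 1) ⊕ (Fin 1 ⊕ Fin (n - a)) → ℝ :=
    fun w => if w = lowVertex n a then 0 else 1 with hy
  have hcard : Fintype.card (Fin (a - 1) ⊕ (Fin 1 ⊕ Fin (n - a))) = n := by
    simp; omega
  have hsum : ∑ w, y w = (n : ℝ) - 1 := by
    have : ∀ w, y w = 1 - if w = lowVertex n a then 1 else 0 := fun w => by
      simp only [hy]; split_ifs <;> norm_num
    simp_rw [this]
    rw [Finset.sum_sub_distrib, Finset.sum_const, Finset.card_univ, hcard]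
    simp
  have hsq : ∀ w, y w * y w = y w := fun w => by simp only [hy]; split_ifs <;> norm_num
  have hform : adjForm (extremalGraph n a) y = ((n : ℝ) - 1) ^ 2 - (n - 1) := by
    have : ∀ u w, (if (extremalGraph n a).Adj u w then y u * y w else 0) =
        y u * y w - if u = w then y u * y w else 0 := fun u w => by
      by_cases hu : u = lowVertex n a
      · simp [hy, hu]
      by_cases hw : w = lowVertex n a
      · simp [hy, hw]
      rw [extremalGraph_adj_iff_ne hu hw]
      split_ifs <;> simp_all
    simp only [adjForm, this, Finset.sum_sub_distrib, Finset.sum_ite_eq, Finset.mem_univ, if_true,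
      hsq, ← Finset.mul_sum, ← Finset.sum_mul, hsum]
    ring
  have := adjForm_le (extremalGraph n a) y
  simp only [hform, pow_two, hsq, hsum] at this
  have hn' : (2 : ℝ) ≤ n := by exact_mod_cast hn
  nlinarith

/-- Zeros of a nonnegative eigenvector spread along edges, so it is nonzero at every vertex that has
a neighbour. For $a=1$ the low vertex is isolated and may carry a zero, but it is then the end of no
edge. -/
theorem rho_lt_rho_extremalGraph {V : Type*} [Fintype V] {G : SimpleGraph V} (ha : 0 < a)
    (han : a ≤ n) (hn : 3 ≤ n) (e : V ≃ Fin (a - 1) ⊕ (Fin 1 ⊕ Fin (n - a)))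
    (hle : ∀ u w, G.Adj u w → (extremalGraph n a).Adj (e u) (e w))
    {p q : V} (hH : (extremalGraph n a).Adj (e p) (e q)) (hG : ¬ G.Adj p q) :
    rho G < rho (extremalGraph n a) := by
  by_contra! hρ
  have : Nonempty V := ⟨p⟩
  have hpos : 0 < rho (extremalGraph n a) := by
    have := sub_two_le_rho_extremalGraph ha han (by omega)
    have hn' : (3 : ℝ) ≤ n := by exact_mod_cast hn
    linarith
  obtain ⟨y, hy0, hnn, hev, hz⟩ := exists_nonneg_eigenvector_of_rho_le e hle hρ
  have hnbr : ∀ u w, (extremalGraph n a).Adj u w → y u = 0 → y w = 0 := by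
    intro u w huw hu
    have h := hev u
    rw [hu, mul_zero, Finset.sum_eq_zero_iff_of_nonneg
      (fun w _ => by split_ifs; exacts [hnn w, le_rfl])] at h
    simpa [huw] using h w (Finset.mem_univ w)
  have hclique : ∀ u, u ≠ lowVertex n a → y u ≠ 0 := by
    intro u hu hu0
    have h1 : ∀ w, w ≠ lowVertex n a → y w = 0 := fun w hw => by
      by_cases huw : u = w
      · rwa [← huw]
      · exact hnbr u w ((extremalGraph_adj_iff_ne hu hw).2 huw) hu0
    have h2 : y (lowVertex n a) = 0 := by
      have h := hev (lowVertex n a)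
      rw [Finset.sum_eq_zero fun w _ => ?_] at h
      · exact (mul_eq_zero.1 h.symm).resolve_left hpos.ne'
      · split_ifs with hw
        · exact h1 w hw.ne'
        · rfl
    apply hy0
    funext w
    by_cases hw : w = lowVertex n a
    · rw [hw]; exact h2
    · exact h1 w hw
  have hne : ∀ u w, (extremalGraph n a).Adj u w → y u ≠ 0 := by
    intro u w huw
    by_cases hu : u = lowVertex n a
    · exact fun h => hclique w (fun hw => huw.ne (hu.trans hw.symm)) (hnbr u w huw h)
    · exact hclique u hu
  rcases mul_eq_zero.1 (hz p q hH hG) with h | h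
  · exact hne _ _ hH h
  · exact hne _ _ hH.symm h

/-- Enlarge the neighbourhood of $v$ to a set $T$ of $a-1$ vertices, send $T$ to $K_{a-1}$ and $v$
to the low vertex; the other vertices all go into a clique. -/
theorem exists_equiv_of_degree_lt {V : Type*} [Fintype V] {G : SimpleGraph V}
    (han : a ≤ n) (hV : Fintype.card V = n) {v : V} (hv : G.degree v < a) :
    ∃ e : V ≃ Fin (a - 1) ⊕ (Fin 1 ⊕ Fin (n - a)),
      ∀ u w, G.Adj u w → (extremalGraph n a).Adj (e u) (e w) := by
  obtain ⟨T, hNT, hTv, hT⟩ := Finset.exists_subsuperset_card_eq (s := G.neighborFinset v)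
    (t := Finset.univ.erase v) (n := a - 1) (fun w hw => by simpa using (G.ne_of_adj (by simpa using hw)).symm)
    (by rw [G.card_neighborFinset_eq_degree]; omega)
    (by rw [Finset.card_erase_of_mem (Finset.mem_univ v), Finset.card_univ]; omega)
  have hvT : v ∉ T := fun h => by simpa using hTv h
  let e₁ : {x // x ∈ T} ≃ Fin (a - 1) := Fintype.equivFinOfCardEq (by simpa using hT)
  have hc : Fintype.card {x // ¬ x ∈ T} = Fintype.card (Fin 1 ⊕ Fin (n - a)) := by
    rw [Fintype.card_subtype_compl]; simp [hT, hV]; omega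
  let e₂ : {x // ¬ x ∈ T} ≃ Fin 1 ⊕ Fin (n - a) :=
    (Fintype.equivOfCardEq hc).setValue ⟨v, hvT⟩ (Sum.inl 0)
  let e : V ≃ Fin (a - 1) ⊕ (Fin 1 ⊕ Fin (n - a)) :=
    (Equiv.sumCompl (· ∈ T)).symm.trans (Equiv.sumCongr e₁ e₂)
  have hev : e v = lowVertex n a := by
    simp [e, Equiv.sumCompl_symm_apply_of_neg hvT, e₂]
  have heT : ∀ w ∈ T, ∃ i, e w = Sum.inl i := fun w hw =>
    ⟨e₁ ⟨w, hw⟩, by simp [e, Equiv.sumCompl_symm_apply_of_pos hw]⟩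
  have hlow : ∀ w, G.Adj v w → (extremalGraph n a).Adj (e v) (e w) := fun w hw => by
    rw [hev, extremalGraph_adj_lowVertex]
    exact heT w (hNT (by simpa using hw))
  refine ⟨e, fun u w huw => ?_⟩
  by_cases hu : u = v
  · subst hu; exact hlow w huw
  by_cases hw : w = v
  · subst hw; exact (hlow u huw.symm).symm
  · exact (extremalGraph_adj_iff_ne (by rw [← hev]; simpa using hu)
      (by rw [← hev]; simpa using hw)).2 (by simpa using huw.ne)

theorem le_degree_of_rho_extremalGraph_le {V : Type*} [Fintype V] {G : SimpleGraph V} (ha : 0 < a)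
    (han : a ≤ n) (hn : 3 ≤ n) (hV : Fintype.card V = n) (hρ : rho (extremalGraph n a) ≤ rho G)
    (hiso : ¬ Nonempty (G ≃g extremalGraph n a)) (v : V) : a ≤ G.degree v := by
  by_contra! hv
  obtain ⟨e, hle⟩ := exists_equiv_of_degree_lt han hV hv
  apply hiso
  refine ⟨e, fun {p q} => ⟨fun h => ?_, hle p q⟩⟩
  by_contra hG
  exact (rho_lt_rho_extremalGraph ha han hn e hle h hG).not_ge hρ

theorem sum_degree_ge_of_rho_extremalGraph_le {V : Type*} [Fintype V] {G : SimpleGraph V}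
    (ha : 0 < a) (han : a ≤ n) (hn : 2 ≤ n) (hV : Fintype.card V = n)
    (hρ : rho (extremalGraph n a) ≤ rho G) : (n - 1) * (n - 2) ≤ ∑ v, G.degree v := by
  have : Nonempty V := Fintype.card_pos_iff.1 (by omega)
  have h1 := card_mul_sq_rho_le G
  have h2 := (sub_two_le_rho_extremalGraph ha han hn).trans hρ
  rw [hV] at h1
  obtain ⟨m, rfl⟩ := Nat.exists_eq_add_of_le hn
  have h3 : (m : ℝ) ^ 2 ≤ rho G ^ 2 := by
    have : (m : ℝ) ≤ rho G := by push_cast at h2; linarith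
    gcongr
  have h4 : ((m : ℝ) + 2) * m ^ 2 ≤ (m + 1) * ((∑ v, G.degree v : ℕ) : ℝ) := by
    push_cast at h1 ⊢
    have : ((m : ℝ) + 2) * m ^ 2 ≤ (m + 2) * rho G ^ 2 := by gcongr
    linarith
  have h5 : (m + 2) * m ^ 2 ≤ (m + 1) * ∑ v, G.degree v := by exact_mod_cast h4
  have e1 : 2 + m - 1 = m + 1 := by omega
  have e2 : 2 + m - 2 = m := by omega
  rw [e1, e2]
  -- Integrality: `h5` only gives a degree sum of at least $m(m+1)-m/(m+1)$.
  by_contra! h6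
  nlinarith

theorem not_hasParityFactor_extremalGraph (ha : 0 < a) (b : ℕ) :
    ¬ HasParityFactor (extremalGraph n a) a b := by
  rintro ⟨F, hF, h⟩
  have h1 := (h (lowVertex n a)).2.1
  have h2 : F.neighborFinset (lowVertex n a) ⊆
      Finset.univ.map (Function.Embedding.inl (α := Fin (a - 1)) (β := Fin 1 ⊕ Fin (n - a))) := by
    intro w hw
    obtain ⟨i, rfl⟩ := extremalGraph_adj_lowVertex.1 (hF (by simpa using hw))
    simp
  have h3 := Finset.card_le_card h2
  rw [F.card_neighborFinset_eq_degree] at h3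
  simp at h3
  omega

end Extremal
-- Exchange argument for a regular factor.
section Factor

open Classical SimpleGraph

variable {V : Type*} [Fintype V]

/-- The degree of a vertex. Unlike `SimpleGraph.degree`, it does not depend on an instance. -/
noncomputable def deg (F : SimpleGraph V) (z : V) : ℕ := F.degree z

theorem card_neighborFinset_eq_deg (F : SimpleGraph V) (z : V) [Fintype (F.neighborSet z)] :
    (F.neighborFinset z).card = deg F z := by
  rw [deg, ← card_neighborFinset_eq_degree]
  congr!

theorem deg_sup_edge {F : SimpleGraph V} {p q : V} (hpq : p ≠ q) (h : ¬ F.Adj p q) (z : V) :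
    deg (F ⊔ edge p q) z = deg F z + (if z = p then 1 else 0) + if z = q then 1 else 0 := by
  by_cases hp : z = p
  · subst hp
    have : (F ⊔ edge z q).neighborFinset z = insert q (F.neighborFinset z) := by
      ext w
      simp only [mem_neighborFinset, sup_adj, edge_adj, Finset.mem_insert]
      grind
    rw [← card_neighborFinset_eq_deg, this, Finset.card_insert_of_notMem (by simpa using h)]
    simp [hpq, deg]
  by_cases hq : z = q
  · subst hq
    have : (F ⊔ edge p z).neighborFinset z = insert p (F.neighborFinset z) := by
      ext w
      simp only [mem_neighborFinset, sup_adj, edge_adj, Finset.mem_insert]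
      grind
    rw [← card_neighborFinset_eq_deg, this,
      Finset.card_insert_of_notMem (by simpa [adj_comm] using h)]
    simp [hp, deg]
  · have : (F ⊔ edge p q).neighborFinset z = F.neighborFinset z := by
      ext w
      simp [edge_adj, hp, hq]
    rw [← card_neighborFinset_eq_deg, this]
    simp [hp, hq, deg]

theorem deg_sdiff_edge {F : SimpleGraph V} {p q : V} (h : F.Adj p q) (z : V) :
    deg (F \ edge p q) z + (if z = p then 1 else 0) + (if z = q then 1 else 0) =
      deg F z := by
  rw [← deg_sup_edge h.ne (by simp [edge_adj, h.ne]) z]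
  congr 1
  rw [sdiff_sup_cancel]
  exact (edge_le_iff _).2 (Or.inr h)

/-- The erasures make each edge count once. With $C$ the complement of $G$, this bounds the joint
non-adjacencies of three vertices. -/
theorem card_edges_ge_three_vertices (C : SimpleGraph V) {v x y : V} (hvx : x ≠ v) (hvy : y ≠ v)
    (hxy : x ≠ y) :
    (C.neighborFinset v).card + ((C.neighborFinset x).erase v).card +
      (((C.neighborFinset y).erase v).erase x).card ≤ C.edgeFinset.card := by
  have hinj : ∀ p : V, Function.Injective fun u : V => s(p, u) := fun p u w h =>
    Sym2.congr_right.1 h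
  rw [← Finset.card_image_of_injective (C.neighborFinset v) (hinj v),
    ← Finset.card_image_of_injective ((C.neighborFinset x).erase v) (hinj x),
    ← Finset.card_image_of_injective (((C.neighborFinset y).erase v).erase x) (hinj y),
    ← Finset.card_union_of_disjoint, ← Finset.card_union_of_disjoint]
  · apply Finset.card_le_card
    intro e he
    simp only [Finset.mem_union, Finset.mem_image, Finset.mem_erase, mem_neighborFinset] at he
    rcases he with (⟨u, hu, rfl⟩ | ⟨u, hu, rfl⟩) | ⟨u, hu, rfl⟩ <;> simp [hu]
  · rw [Finset.disjoint_left]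
    intro e he
    simp only [Finset.mem_union, Finset.mem_image, Finset.mem_erase, mem_neighborFinset] at he ⊢
    rcases he with ⟨u, hu, rfl⟩ | ⟨u, hu, rfl⟩ <;> rintro ⟨w, hw, h⟩ <;>
      simp only [Sym2.eq_iff] at h <;> grind
  · rw [Finset.disjoint_left]
    intro e he
    simp only [Finset.mem_image, Finset.mem_erase, mem_neighborFinset] at he ⊢
    rcases he with ⟨u, hu, rfl⟩
    rintro ⟨w, hw, h⟩
    simp only [Sym2.eq_iff] at h
    grind

theorem degree_add_degree_compl {G C : SimpleGraph V} (hC : C = Gᶜ) (v : V) :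
    C.degree v + G.degree v + 1 = Fintype.card V := by
  have h1 : C.degree v = Fintype.card V - 1 - G.degree v := by
    subst hC
    rw [← G.degree_compl]
    congr!
  have h2 := G.degree_lt_card_verts v
  omega

theorem card_edges_compl_lt {G C : SimpleGraph V} (hC : C = Gᶜ) (hV : 2 ≤ Fintype.card V)
    (hsum : (Fintype.card V - 1) * (Fintype.card V - 2) ≤ ∑ v, G.degree v) :
    C.edgeFinset.card < Fintype.card V := by
  have h1 := C.sum_degrees_eq_twice_card_edges
  have h2 : ∑ v, C.degree v + ∑ v, G.degree v = Fintype.card V * (Fintype.card V - 1) := by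
    rw [← Finset.sum_add_distrib, Finset.sum_congr rfl (g := fun _ => Fintype.card V - 1),
      Finset.sum_const, Finset.card_univ, smul_eq_mul]
    intro v _
    have := degree_add_degree_compl hC v
    omega
  obtain ⟨m, hm⟩ := Nat.exists_eq_add_of_le hV
  rw [hm] at hsum h2 ⊢
  have e1 : 2 + m - 1 = m + 1 := by omega
  have e2 : 2 + m - 2 = m := by omega
  rw [e1] at hsum h2
  rw [e2] at hsum
  nlinarith

/-- `F` is a subgraph of `G` of maximum degree at most `a` in which `v` has neighbourhood `S`. -/
structure IsAdmissible (G : SimpleGraph V) (a : ℕ) (v : V) (S : Finset V) (F : SimpleGraph V) :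
    Prop where
  le : F ≤ G
  adj_iff : ∀ z, F.Adj v z ↔ z ∈ S
  degree_le : ∀ z, deg F z ≤ a

theorem exists_isAdmissible {G : SimpleGraph V} {a : ℕ} {v : V} {S : Finset V} (ha : 0 < a)
    (hS : S ⊆ G.neighborFinset v) (hcard : S.card = a) : ∃ F, IsAdmissible G a v S F := by
  have hvS : v ∉ S := fun h => by simpa using hS h
  let F : SimpleGraph V :=
    { Adj := fun p q => (p = v ∧ q ∈ S) ∨ (q = v ∧ p ∈ S)
      symm := ⟨fun p q h => h.symm⟩
      loopless := ⟨fun p h => by rcases h with ⟨rfl, h⟩ | ⟨rfl, h⟩ <;> exact hvS h⟩ }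
  have hF : ∀ p q, F.Adj p q ↔ (p = v ∧ q ∈ S) ∨ (q = v ∧ p ∈ S) := fun _ _ => Iff.rfl
  refine ⟨F, ?_, ?_, ?_⟩
  · intro p q h
    rcases h with ⟨rfl, h⟩ | ⟨rfl, h⟩
    · simpa using hS h
    · simpa [adj_comm] using hS h
  · intro z
    rw [hF]
    grind
  · intro z
    by_cases hz : z = v
    · rw [← card_neighborFinset_eq_deg, ← hcard]
      apply Finset.card_le_card
      intro w hw
      rw [mem_neighborFinset, hF] at hw
      grind
    · refine le_trans ?_ (Nat.succ_le_of_lt ha)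
      rw [← card_neighborFinset_eq_deg]
      have : Nonempty V := ⟨v⟩
      apply Finset.card_le_one_iff_subset_singleton.2 ⟨v, ?_⟩
      intro w hw
      rw [mem_neighborFinset, hF] at hw
      rw [Finset.mem_singleton]
      grind

variable {G C F : SimpleGraph V} {a : ℕ} {v : V} {S : Finset V}

theorem IsAdmissible.degree_eq (hF : IsAdmissible G a v S F) (hcard : S.card = a) :
    deg F v = a := by
  rw [← card_neighborFinset_eq_deg, ← hcard]
  congr 1
  ext z
  rw [mem_neighborFinset, hF.adj_iff]

theorem IsAdmissible.sup_edge (hF : IsAdmissible G a v S F) {p q : V} (hpq : G.Adj p q)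
    (hn : ¬ F.Adj p q) (hp : p ≠ v) (hq : q ≠ v) (hpa : deg F p < a) (hqa : deg F q < a) :
    IsAdmissible G a v S (F ⊔ edge p q) := by
  refine ⟨sup_le hF.le ((edge_le_iff _).2 (Or.inr hpq)), fun z => ?_, fun z => ?_⟩
  · rw [← hF.adj_iff, sup_adj, edge_adj]
    grind
  · have h0 := hF.degree_le z
    have := hpq.ne
    rw [deg_sup_edge hpq.ne hn]
    split_ifs with h1 h2 h2
    · exact absurd (h1.symm.trans h2) this
    · subst h1; omega
    · subst h2; omega
    · omega

theorem IsAdmissible.sdiff_edge (hF : IsAdmissible G a v S F) {p q : V} (h : F.Adj p q)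
    (hp : p ≠ v) (hq : q ≠ v) : IsAdmissible G a v S (F \ edge p q) := by
  refine ⟨sdiff_le.trans hF.le, fun z => ?_, fun z => ?_⟩
  · rw [← hF.adj_iff, sdiff_adj, edge_adj]
    grind
  · have h0 := hF.degree_le z
    have := deg_sdiff_edge h z
    omega

theorem sum_deg_sup_edge {p q : V} (hpq : p ≠ q) (h : ¬ F.Adj p q) :
    ∑ z, deg (F ⊔ edge p q) z = ∑ z, deg F z + 2 := by
  simp [deg_sup_edge hpq h, Finset.sum_add_distrib]

theorem sum_deg_sdiff_edge {p q : V} (h : F.Adj p q) :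
    ∑ z, deg (F \ edge p q) z + 2 = ∑ z, deg F z := by
  rw [← Finset.sum_congr rfl fun z _ => deg_sdiff_edge h z]
  simp [Finset.sum_add_distrib]

/-- The vertices other than `v` which can be joined to `x` by an edge of `G` outside `F`. -/
noncomputable def freeNeighbors (G F : SimpleGraph V) (v x : V) : Finset V :=
  Finset.univ.filter fun u => G.Adj x u ∧ ¬ F.Adj x u ∧ u ≠ v

theorem mem_freeNeighbors {x u : V} :
    u ∈ freeNeighbors G F v x ↔ G.Adj x u ∧ ¬ F.Adj x u ∧ u ≠ v := by
  simp [freeNeighbors]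

theorem card_le_card_freeNeighbors (hC : C = Gᶜ) (x : V) :
    Fintype.card V ≤ (freeNeighbors G F v x).card + deg F x + 2 +
      ((C.neighborFinset x).erase v).card := by
  have h : (Finset.univ : Finset V) ⊆ freeNeighbors G F v x ∪ F.neighborFinset x ∪ {x, v} ∪
      (C.neighborFinset x).erase v := by
    intro u _
    simp only [Finset.mem_union, mem_freeNeighbors, mem_neighborFinset, Finset.mem_insert,
      Finset.mem_singleton, Finset.mem_erase]
    rw [hC, compl_adj]
    grind
  have h1 := Finset.card_le_card h
  rw [Finset.card_univ] at h1
  have h2 := Finset.card_union_le (freeNeighbors G F v x ∪ F.neighborFinset x ∪ {x, v})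
    ((C.neighborFinset x).erase v)
  have h3 := Finset.card_union_le (freeNeighbors G F v x ∪ F.neighborFinset x) {x, v}
  have h4 := Finset.card_union_le (freeNeighbors G F v x) (F.neighborFinset x)
  have h5 : ({x, v} : Finset V).card ≤ 2 := Finset.card_le_two
  rw [card_neighborFinset_eq_deg] at h4
  omega

/-- If all vertices of `A` have degree `a` and no edge joins `A` to `B`, double counting the edges
leaving `A` bounds the sizes of `A` and `B`. -/
theorem card_add_card_le_of_forall_not_adj {A B : Finset V} {x y : V} (hxy : x ≠ y)
    (hF : ∀ z, deg F z ≤ a) (hx : deg F x < a) (hy : deg F y < a) (hxB : x ∉ B)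
    (hyB : y ∉ B) (hA : ∀ u ∈ A, deg F u = a) (hAB : ∀ u ∈ A, ∀ w ∈ B, ¬ F.Adj u w) :
    a * (A.card + B.card) + 2 ≤ a * Fintype.card V := by
  have h1 : ∑ u ∈ A, deg F u = ∑ w ∈ Bᶜ, (A.bipartiteBelow F.Adj w).card := by
    rw [← Finset.sum_card_bipartiteAbove_eq_sum_card_bipartiteBelow]
    refine Finset.sum_congr rfl fun u hu => ?_
    rw [← card_neighborFinset_eq_deg]
    congr 1
    ext w
    simp only [mem_neighborFinset, Finset.mem_bipartiteAbove, Finset.mem_compl]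
    exact ⟨fun h => ⟨fun hw => hAB u hu w hw h, h⟩, fun h => h.2⟩
  -- The gain of 2 comes from $x$ and $y$, which lie outside $B$ and have degree below $a$.
  have h2 : ∑ w ∈ Bᶜ, (A.bipartiteBelow F.Adj w).card + 2 ≤ ∑ w ∈ Bᶜ, a := by
    have h3 : ∀ w ∈ Bᶜ, (A.bipartiteBelow F.Adj w).card + (if w = x then 1 else 0) +
        (if w = y then 1 else 0) ≤ a := by
      intro w _
      have h4 : (A.bipartiteBelow F.Adj w).card ≤ deg F w := by
        rw [← card_neighborFinset_eq_deg]
        refine Finset.card_le_card fun u hu => ?_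
        rw [mem_neighborFinset]
        exact ((Finset.mem_bipartiteBelow _).1 hu).2.symm
      have := hF w
      split_ifs with h5 h6 h6
      · exact absurd (h5.symm.trans h6) hxy
      · subst h5; omega
      · subst h6; omega
      · omega
    have h4 := Finset.sum_le_sum h3
    simp [Finset.sum_add_distrib, hxB, hyB] at h4 ⊢
    omega
  rw [← h1, Finset.sum_congr rfl hA, Finset.sum_const, Finset.sum_const, Finset.card_compl] at h2
  have h3 : B.card ≤ Fintype.card V := Finset.card_le_univ B
  obtain ⟨k, hk⟩ := Nat.exists_eq_add_of_le h3
  rw [hk, Nat.add_sub_cancel_left] at h2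
  rw [hk]
  simp only [smul_eq_mul] at h2
  nlinarith

/-! ### Augmentation when the complement is sparse. -/

section Dense

variable (hC : C = Gᶜ) (hn : 2 * (a + 1) ^ 2 ≤ Fintype.card V) (hE : C.edgeFinset.card < Fintype.card V)
  (hmin : ∀ u, G.degree v ≤ G.degree u)

include hC hmin in
theorem card_erase_neighborFinset_compl_le (x : V) :
    ((C.neighborFinset x).erase v).card ≤ C.degree v := by
  refine (Finset.card_le_card (Finset.erase_subset _ _)).trans ?_
  have := hmin x
  have := degree_add_degree_compl hC x
  have := degree_add_degree_compl hC v
  rw [card_neighborFinset_eq_degree]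
  omega

include hC hE hmin hn in
-- Either a free edge joins $x$ or $y$ to a deficient vertex and is added, or an edge $uw$ of $F$
-- from a free neighbour of $x$ to one of $y$ is replaced by $xu$ and $yw$. Failing both, the free
-- neighbourhoods contradict `card_add_card_le_of_forall_not_adj`.
theorem IsAdmissible.exists_sum_degree_lt (ha : 0 < a) (hF : IsAdmissible G a v S F)
    (hcard : S.card = a) {x y : V} (hxy : x ≠ y) (hx : deg F x < a) (hy : deg F y < a) :
    ∃ F', IsAdmissible G a v S F' ∧ ∑ z, deg F z < ∑ z, deg F' z := by
  have hv := hF.degree_eq hcard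
  have hxv : x ≠ v := by rintro rfl; omega
  have hyv : y ≠ v := by rintro rfl; omega
  by_cases hfree : ∃ p ∈ ({x, y} : Finset V), ∃ u ∈ freeNeighbors G F v p, deg F u < a
  · obtain ⟨p, hp, u, hu, hua⟩ := hfree
    obtain ⟨h1, h2, h3⟩ := mem_freeNeighbors.1 hu
    have hpv : p ≠ v ∧ deg F p < a := by
      rcases Finset.mem_insert.1 hp with rfl | hp
      · exact ⟨hxv, hx⟩
      · rw [Finset.mem_singleton.1 hp]; exact ⟨hyv, hy⟩
    refine ⟨_, hF.sup_edge h1 h2 hpv.1 h3 hpv.2 hua, ?_⟩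
    rw [sum_deg_sup_edge h1.ne h2]
    omega
  push Not at hfree
  have hsx : ∀ u ∈ freeNeighbors G F v x, deg F u = a := fun u hu =>
    le_antisymm (hF.degree_le u) (hfree x (by simp) u hu)
  have hsy : ∀ u ∈ freeNeighbors G F v y, deg F u = a := fun u hu =>
    le_antisymm (hF.degree_le u) (hfree y (by simp) u hu)
  obtain ⟨u, hu, w, hw, huw⟩ : ∃ u ∈ freeNeighbors G F v x, ∃ w ∈ freeNeighbors G F v y,
      F.Adj u w := by
    by_contra! hno
    have h1 := card_add_card_le_of_forall_not_adj hxy hF.degree_le hx hy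
      (fun h => hx.ne (hsy x h)) (fun h => hy.ne (hsy y h)) hsx hno
    have h2 := card_le_card_freeNeighbors (F := F) (v := v) hC x
    have h3 := card_le_card_freeNeighbors (F := F) (v := v) hC y
    have h4 := card_edges_ge_three_vertices C hxv hyv hxy
    have h5 := card_erase_neighborFinset_compl_le hC hmin x
    have h6 := card_erase_neighborFinset_compl_le hC hmin y
    have h7 := Finset.pred_card_le_card_erase (s := (C.neighborFinset y).erase v) (a := x)
    rw [card_neighborFinset_eq_degree] at h4
    generalize (freeNeighbors G F v x).card = A at *
    generalize (freeNeighbors G F v y).card = B at *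
    -- By `h4`–`h7`, $x$ and $y$ have at most $2n/3$ non-neighbours other than $v$ in total, so
    -- $A+B\ge 4n/3-2a-2$. This is at least $n$ once $n\ge 6a+6$, which `hn` yields only for $a\ge
    -- 2$.
    rcases Nat.lt_or_ge 1 a with ha2 | ha2
    · have h8 : 6 * a + 6 ≤ Fintype.card V := by nlinarith
      have h9 : Fintype.card V ≤ A + B := by omega
      have := Nat.mul_le_mul_left a h9
      omega
    · obtain rfl : a = 1 := by omega
      omega
  obtain ⟨hxu, hnxu, huv⟩ := mem_freeNeighbors.1 hu
  obtain ⟨hyw, hnyw, hwv⟩ := mem_freeNeighbors.1 hw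
  have hua := hsx u hu
  have hwa := hsy w hw
  have hux : u ≠ x := hxu.ne'
  have hwy : w ≠ y := hyw.ne'
  have huy : u ≠ y := by rintro rfl; omega
  have hwx : w ≠ x := by rintro rfl; omega
  have hd1 := deg_sdiff_edge huw
  have hn1 : ¬ (F \ edge u w).Adj x u := fun h => hnxu h.1
  have hd2 := deg_sup_edge hux.symm hn1
  have hn2 : ¬ (F \ edge u w ⊔ edge x u).Adj y w := by
    rw [sup_adj, edge_adj]
    rintro (h | h)
    · exact hnyw h.1
    · grind
  have hF1 := hF.sdiff_edge huw huv hwv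
  have hF2 := hF1.sup_edge hxu hn1 hxv huv
    (by have := hd1 x; simp [hux.symm, hwx.symm] at this; omega)
    (by have := hd1 u; simp [huw.ne] at this; omega)
  have hF3 := hF2.sup_edge hyw hn2 hyv hwv
    (by have := hd1 y; have := hd2 y; simp [hxy.symm, huy.symm, hwy.symm] at *; omega)
    (by have := hd1 w; have := hd2 w; simp [hwx, huw.ne'] at *; omega)
  refine ⟨_, hF3, ?_⟩
  rw [sum_deg_sup_edge hwy.symm hn2, sum_deg_sup_edge hux.symm hn1,
    ← sum_deg_sdiff_edge huw]
  omega

include hC hE hmin hn in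
theorem exists_regular_factor_of_min_degree (ha : 0 < a) (hv : a ≤ G.degree v)
    (hpar : Even (Fintype.card V * a)) : ∃ F ≤ G, ∀ z, deg F z = a := by
  obtain ⟨S, hS, hcard⟩ := Finset.exists_subset_card_eq (s := G.neighborFinset v)
    (n := a) (by rwa [card_neighborFinset_eq_degree])
  obtain ⟨F, hF, hmax⟩ : ∃ F, IsAdmissible G a v S F ∧
      ∀ F', IsAdmissible G a v S F' → ∑ z, deg F' z ≤ ∑ z, deg F z := by
    obtain ⟨F, hF, hmax⟩ := (Set.toFinite {F | IsAdmissible G a v S F}).exists_maximalFor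
      (fun F => ∑ z, deg F z) _ (exists_isAdmissible ha hS hcard)
    exact ⟨F, hF, fun F' hF' => (le_total _ _).elim id (hmax hF')⟩
  refine ⟨F, hF.le, fun x => ?_⟩
  by_contra hx
  have hxa : deg F x < a := lt_of_le_of_ne (hF.degree_le x) hx
  have hxv : x ≠ v := by rintro rfl; exact hx (hF.degree_eq hcard)
  have hsat : ∀ u, u ≠ x → deg F u = a := by
    intro u hu
    by_contra h
    obtain ⟨F', hF', hlt⟩ := hF.exists_sum_degree_lt hC hn hE hmin ha hcard hu.symm hxa
      (lt_of_le_of_ne (hF.degree_le u) h)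
    exact (hmax F' hF').not_gt hlt
  -- The degree sum and $na$ are both even, so the only deficiency is even.
  have hx2 : deg F x + 2 ≤ a := by
    have h1 : ∑ z, deg F z + a = deg F x + Fintype.card V * a := by
      rw [← Finset.add_sum_erase _ _ (Finset.mem_univ x), Finset.sum_congr rfl
        (fun u hu => hsat u (Finset.ne_of_mem_erase hu)), Finset.sum_const,
        Finset.card_erase_of_mem (Finset.mem_univ x), Finset.card_univ, smul_eq_mul, add_assoc,
        ← Nat.succ_mul, Nat.succ_eq_add_one, Nat.sub_add_cancel (Fintype.card_pos_iff.2 ⟨x⟩)]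
    have h2 : ∑ z, deg F z = _ := F.sum_degrees_eq_twice_card_edges
    rw [h2] at h1
    obtain ⟨k, hk⟩ := hpar
    omega
  obtain ⟨u, hu, huS⟩ : ∃ u ∈ freeNeighbors G F v x, u ∉ S := by
    apply Finset.exists_mem_notMem_of_card_lt_card
    have h2 := card_le_card_freeNeighbors (F := F) (v := v) hC x
    have h5 := card_erase_neighborFinset_compl_le hC hmin x
    have h8 : 4 * a + 4 ≤ Fintype.card V := by nlinarith
    -- Here $y$ is a dummy: only the terms of $v$ and $x$ matter. They leave $x$ fewer than $n/2$
    -- non-neighbours apart from $v$, hence more than $a$ free neighbours.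
    obtain ⟨y, hy⟩ : ∃ y, y ∉ ({v, x} : Finset V) := by
      by_contra! h
      have := Finset.card_le_card (fun y (_ : y ∈ Finset.univ) => h y)
      have h5 : ({v, x} : Finset V).card ≤ 2 := Finset.card_le_two
      rw [Finset.card_univ] at this
      omega
    simp only [Finset.mem_insert, Finset.mem_singleton, not_or] at hy
    have h4 := card_edges_ge_three_vertices C hxv hy.1 (Ne.symm hy.2)
    rw [card_neighborFinset_eq_degree] at h4
    omega
  obtain ⟨hxu, hnxu, huv⟩ := mem_freeNeighbors.1 hu
  obtain ⟨w, huw⟩ : ∃ w, F.Adj u w := by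
    have : 0 < F.degree u := by change 0 < deg F u; rw [hsat u hxu.ne']; exact ha
    exact (F.degree_pos_iff_exists_adj u).1 this
  have hwx : w ≠ x := by rintro rfl; exact hnxu huw.symm
  -- The choice $u\notin S$ ensures that $uw$ is not a fixed edge at $v$. Replacing it by $xu$ keeps
  -- the degree sum and leaves both $x$ and $w$ deficient.
  have hwv : w ≠ v := by rintro rfl; exact huS ((hF.adj_iff u).1 huw.symm)
  have hd1 := deg_sdiff_edge huw
  have hn1 : ¬ (F \ edge u w).Adj x u := fun h => hnxu h.1
  have hd2 := deg_sup_edge hxu.ne hn1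
  have hF1 := hF.sdiff_edge huw huv hwv
  have hF2 := hF1.sup_edge hxu hn1 hxv huv
    (by have := hd1 x; simp [hxu.ne, hwx.symm] at this; omega)
    (by have := hd1 u; have := hF.degree_le u; simp [huw.ne] at *; omega)
  obtain ⟨F', hF', hlt⟩ := hF2.exists_sum_degree_lt hC hn hE hmin ha hcard hwx.symm
    (by have := hd1 x; have := hd2 x; simp [hxu.ne, hwx.symm] at *; omega)
    (by have := hd1 w; have := hd2 w; have := hF.degree_le w; simp [hwx, huw.ne'] at *; omega)
  have h1 := hmax F' hF'
  rw [sum_deg_sup_edge hxu.ne hn1, sum_deg_sdiff_edge huw] at hlt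
  omega

end Dense

/-- A graph of order `n ≥ 2 (a + 1) ^ 2`, with `n * a` even, whose minimum degree is at least `a`
and whose complement has fewer than `n` edges has an `a`-factor. -/
theorem exists_regular_factor (hC : C = Gᶜ) (hn : 2 * (a + 1) ^ 2 ≤ Fintype.card V)
    (hE : C.edgeFinset.card < Fintype.card V) (ha : 0 < a) (hdeg : ∀ v, a ≤ G.degree v)
    (hpar : Even (Fintype.card V * a)) : ∃ F ≤ G, ∀ z, deg F z = a := by
  have : Nonempty V := Fintype.card_pos_iff.1 (by nlinarith)
  obtain ⟨v, hv⟩ := Finite.exists_min fun u => G.degree u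
  exact exists_regular_factor_of_min_degree hC hn hE hv ha (hdeg v) hpar

end Factor

end ParityFactor

theorem theorem1p5 (a b n : ℕ) (ha : 0 < a) (hab : a ≤ b) (hpar : a ≡ b [MOD 2])
    (hna : Even (n * a))
    (hn : max (2 * (a : ℤ) * ((a : ℤ) + 1) + (b : ℤ) - 3)
      ((2 * (a : ℤ) + 2) * ((a : ℤ) + 1)) ≤ (n : ℤ)) :
    (∀ (V : Type*) [Fintype V] (G : SimpleGraph V), Fintype.card V = n →
      ParityFactor.rho (ParityFactor.extremalGraph n a) ≤ ParityFactor.rho G →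
      ¬ Nonempty (G ≃g ParityFactor.extremalGraph n a) →
      ParityFactor.HasParityFactor G a b) ∧
    ¬ ParityFactor.HasParityFactor (ParityFactor.extremalGraph n a) a b := by
  refine ⟨fun V _ G hV hρ hiso => ?_, ParityFactor.not_hasParityFactor_extremalGraph ha b⟩
  have hn2 : 2 * (a + 1) ^ 2 ≤ n := by
    have := (le_max_right _ _).trans hn
    zify
    linarith
  have han : a ≤ n := by nlinarith
  have hn8 : 8 ≤ n := by nlinarith
  have hE := ParityFactor.card_edges_compl_lt (G := G) rfl (by omega) (by
    rw [hV]
    exact ParityFactor.sum_degree_ge_of_rho_extremalGraph_le ha han (by omega) hV hρ)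
  obtain ⟨F, hFG, hF⟩ := ParityFactor.exists_regular_factor rfl (by rwa [hV]) hE ha
    (ParityFactor.le_degree_of_rho_extremalGraph_le ha han (by omega) hV hρ hiso) (by rwa [hV])
  exact ⟨F, hFG, fun v => by
    have h := hF v
    rw [ParityFactor.deg] at h
    rw [h]
    exact ⟨hpar, le_rfl, hab⟩⟩
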